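/- Let $M$ be a compact complex manifold with holomorphic tangent bundle $T^{1,0}$, and let $\Lambda$ be a holomorphic Poisson structure on $M$, i.e. a smooth section of $\wedge^2T^{1,0}$ with $\bar\partial\Lambda=0$ and $[\Lambda,\Lambda]=0$ (Schouten bracket). Put $L=T^{1,0}\oplus T^{*(0,1)}$ and consider $$C^\infty(M,\mathbb C)\xrightarrow{\ \bar\partial_\Lambda\ }C^\infty(L)\xrightarrow{\ \bar\partial_\Lambda\ }C^\infty(\wedge^2L),\qquad \bar\partial_\Lambda=\bar\partial+[\Lambda,-],$$ where $[\Lambda,-]$ is the Schouten bracket extended to sections of $\wedge^\bullet L$ (with $[X,\bar\eta]=\mathcal L_X\bar\eta=\iota_X\partial\bar\eta$ for a $(1,0)$-vector field $X$ and a $(0,1)$-form $\bar\eta$, regarded as sections of $L$). Let $H^1_{\bar\partial_\Lambda}$ be the kernel of the second map modulo the image of the first. Suppose that the Dolbeault cohomology $H^1(M,\mathcal O)$ (smooth $\bar\partial$-closed $(0,1)$-forms modulo the forms $\bar\partial f$, $f\in C^\infty(M,\mathbb C)$) vanishes. Then $$H^1_{\bar\partial_\Lambda}=\{W\in H^0(M,T^{1,0})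 : [\Lambda,W]=0\}.$$ More precisely, every holomorphic vector field $W$ with $[\Lambda,W]=0$ is $\bar\partial_\Lambda$-closed as a section of $L$, and $W\mapsto$ (class of $W$) is an isomorphism of complex vector spaces from the right hand side onto $H^1_{\bar\partial_\Lambda}$. -/

import Mathlib

open scoped Manifold ContDiff

noncomputable section

namespace HolPoisson

/-! ### Wirtinger calculus on `ℂⁿ` -/

/-- The model space `ℂⁿ`. -/
abbrev Cn (n : ℕ) : Type := EuclideanSpace ℂ (Fin n)

/-- The `i`-th coordinate on `ℂⁿ`. -/
def coord {n : ℕ} (i : Fin n) : Cn n →ₗ[ℂ] ℂ :=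
  (EuclideanSpace.proj i : Cn n →L[ℂ] ℂ).toLinearMap

theorem eq_sum_single {n : ℕ} (u : Cn n) :
    u = ∑ k, coord k u • (EuclideanSpace.single k 1 : Cn n) := by
  ext i
  simp [coord, EuclideanSpace.single, Pi.single_apply]

theorem dual_eq_sum {n : ℕ} (α : Cn n →ₗ[ℂ] ℂ) :
    α = ∑ k, α (EuclideanSpace.single k 1) • coord k := by
  refine LinearMap.ext fun u => ?_
  conv_lhs => rw [eq_sum_single u]
  simp only [map_sum, map_smul, LinearMap.sum_apply, LinearMap.smul_apply, smul_eq_mul]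
  exact Finset.sum_congr rfl fun k _ => mul_comm _ _

theorem real_smul_formula {n : ℕ} (T : Cn n →L[ℝ] ℂ) (c : ℂ) (u : Cn n) :
    T (c • u) = c.re * T u + c.im * T (Complex.I • u) := by
  have : c • u = c.re • u + c.im • (Complex.I • u) := by
    ext k
    have hc := Complex.re_add_im c
    simp only [PiLp.smul_apply, PiLp.add_apply, smul_eq_mul, Complex.real_smul]
    linear_combination (-(u k)) * hc
  rw [this]
  simp

/-- The complex linear part `v ↦ (T v - i T (i v)) / 2` of a real linear functional `T` on `ℂⁿ`. -/
def linPart {n : ℕ} (T : Cn n →L[ℝ] ℂ) : Cn n →ₗ[ℂ] ℂ where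
  toFun := fun v => (T v - Complex.I * T (Complex.I • v)) / 2
  map_add' := fun v w => by simp only [smul_add, map_add]; ring
  map_smul' := fun c v => by
    have hc := Complex.re_add_im c
    have h2 : Complex.I • c • v = (Complex.I * c) • v := smul_smul _ _ _
    rw [h2, real_smul_formula T c, real_smul_formula T (Complex.I * c), RingHom.id_apply,
      smul_eq_mul]
    simp only [Complex.mul_re, Complex.mul_im, Complex.I_re, Complex.I_im]
    push_cast
    linear_combination ((T v - Complex.I * T (Complex.I • v)) / 2) * hc
      + ((c.im : ℂ) * T (Complex.I • v) / 2) * Complex.I_sq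

/-- The conjugate linear part `v ↦ (T v + i T (i v)) / 2` of a real linear functional `T`
on `ℂⁿ`. -/
def conjPart {n : ℕ} (T : Cn n →L[ℝ] ℂ) : Cn n →ₛₗ[starRingEnd ℂ] ℂ where
  toFun := fun v => (T v + Complex.I * T (Complex.I • v)) / 2
  map_add' := fun v w => by simp only [smul_add, map_add]; ring
  map_smul' := fun c v => by
    have hc : (c.re : ℂ) - c.im * Complex.I = starRingEnd ℂ c := by
      apply Complex.ext <;> simp
    have h2 : Complex.I • c • v = (Complex.I * c) • v := smul_smul _ _ _
    rw [h2, real_smul_formula T c, real_smul_formula T (Complex.I * c), smul_eq_mul]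
    simp only [Complex.mul_re, Complex.mul_im, Complex.I_re, Complex.I_im]
    push_cast
    linear_combination ((T v + Complex.I * T (Complex.I • v)) / 2) * hc
      + ((c.im : ℂ) * T (Complex.I • v) / 2) * Complex.I_sq

theorem linPart_add {n : ℕ} (S T : Cn n →L[ℝ] ℂ) : linPart (S + T) = linPart S + linPart T := by
  refine LinearMap.ext fun v => ?_
  simp only [linPart, LinearMap.add_apply, LinearMap.coe_mk, AddHom.coe_mk, add_apply]
  ring

theorem linPart_smul {n : ℕ} (c : ℂ) (T : Cn n →L[ℝ] ℂ) : linPart (c • T) = c • linPart T := by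
  refine LinearMap.ext fun v => ?_
  simp only [linPart, LinearMap.smul_apply, LinearMap.coe_mk, AddHom.coe_mk, smul_apply,
    smul_eq_mul]
  ring

theorem conjPart_add {n : ℕ} (S T : Cn n →L[ℝ] ℂ) :
    conjPart (S + T) = conjPart S + conjPart T := by
  refine LinearMap.ext fun v => ?_
  simp only [conjPart, LinearMap.add_apply, LinearMap.coe_mk, AddHom.coe_mk, add_apply]
  ring

theorem conjPart_smul {n : ℕ} (c : ℂ) (T : Cn n →L[ℝ] ℂ) : conjPart (c • T) = c • conjPart T := by
  refine LinearMap.ext fun v => ?_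
  simp only [conjPart, LinearMap.smul_apply, LinearMap.coe_mk, AddHom.coe_mk, smul_apply,
    smul_eq_mul]
  ring

theorem linPart_comp {n : ℕ} (S T : Cn n →L[ℝ] ℂ) (A : Cn n →L[ℂ] Cn n)
    (h : ∀ v, S (A v) = T v) (v : Cn n) : linPart S (A v) = linPart T v := by
  simp only [linPart, LinearMap.coe_mk, AddHom.coe_mk, ← h, map_smul]

theorem conjPart_comp {n : ℕ} (S T : Cn n →L[ℝ] ℂ) (A : Cn n →L[ℂ] Cn n)
    (h : ∀ v, S (A v) = T v) (v : Cn n) : conjPart S (A v) = conjPart T v := by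
  simp only [conjPart, LinearMap.coe_mk, AddHom.coe_mk, ← h, map_smul]

theorem alt_left {V : Type*} [AddCommGroup V] [Module ℂ V] (B : V [⋀^Fin 2]→ₗ[ℂ] ℂ) {n : ℕ}
    (c : Fin n → ℂ) (γ : Fin n → V) (β : V) :
    B ![∑ i, c i • γ i, β] = ∑ i, c i * B ![γ i, β] := by
  have hB : ∀ α : V, B ![α, β] = B.toMultilinearMap.toLinearMap ![0, β] 0 α := by
    intro α
    simp only [MultilinearMap.toLinearMap_apply, AlternatingMap.coe_multilinearMap]
    congr 1
    ext k : 1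
    fin_cases k <;> simp
  rw [hB, map_sum]
  exact Finset.sum_congr rfl fun i _ => by rw [map_smul, ← hB, smul_eq_mul]

theorem alt_right {V : Type*} [AddCommGroup V] [Module ℂ V] (B : V [⋀^Fin 2]→ₗ[ℂ] ℂ) {n : ℕ}
    (c : Fin n → ℂ) (γ : Fin n → V) (β : V) :
    B ![β, ∑ i, c i • γ i] = ∑ i, c i * B ![β, γ i] := by
  have hB : ∀ α : V, B ![β, α] = B.toMultilinearMap.toLinearMap ![β, 0] 1 α := by
    intro α
    simp only [MultilinearMap.toLinearMap_apply, AlternatingMap.coe_multilinearMap]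
    congr 1
    ext k : 1
    fin_cases k <;> simp
  rw [hB, map_sum]
  exact Finset.sum_congr rfl fun i _ => by rw [map_smul, ← hB, smul_eq_mul]

/-- The Wirtinger derivative `∂g/∂z_j = (∂g/∂x_j - i ∂g/∂y_j) / 2` at the point `y`. -/
def wirt {n : ℕ} (g : Cn n → ℂ) (y : Cn n) (j : Fin n) : ℂ :=
  linPart (fderiv ℝ g y) (EuclideanSpace.single j 1)

/-- The Wirtinger derivative `∂g/∂z̄_j = (∂g/∂x_j + i ∂g/∂y_j) / 2` at the point `y`. -/
def wirtBar {n : ℕ} (g : Cn n → ℂ) (y : Cn n) (j : Fin n) : ℂ :=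
  conjPart (fderiv ℝ g y) (EuclideanSpace.single j 1)

theorem wirt_add {n : ℕ} {g h : Cn n → ℂ} {y : Cn n} (hg : DifferentiableAt ℝ g y)
    (hh : DifferentiableAt ℝ h y) (j : Fin n) :
    wirt (fun z => g z + h z) y j = wirt g y j + wirt h y j := by
  simp only [wirt, linPart, LinearMap.coe_mk, AddHom.coe_mk, fderiv_fun_add hg hh,
    add_apply]
  ring

theorem wirt_const_mul {n : ℕ} {g : Cn n → ℂ} {y : Cn n} (hg : DifferentiableAt ℝ g y)
    (c : ℂ) (j : Fin n) : wirt (fun z => c * g z) y j = c * wirt g y j := by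
  simp only [wirt, linPart, LinearMap.coe_mk, AddHom.coe_mk, fderiv_const_mul hg,
    smul_apply, smul_eq_mul]
  ring

theorem wirtBar_add {n : ℕ} {g h : Cn n → ℂ} {y : Cn n} (hg : DifferentiableAt ℝ g y)
    (hh : DifferentiableAt ℝ h y) (j : Fin n) :
    wirtBar (fun z => g z + h z) y j = wirtBar g y j + wirtBar h y j := by
  simp only [wirtBar, conjPart, LinearMap.coe_mk, AddHom.coe_mk, fderiv_fun_add hg hh,
    add_apply]
  ring

theorem wirtBar_const_mul {n : ℕ} {g : Cn n → ℂ} {y : Cn n} (hg : DifferentiableAt ℝ g y)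
    (c : ℂ) (j : Fin n) : wirtBar (fun z => c * g z) y j = c * wirtBar g y j := by
  simp only [wirtBar, conjPart, LinearMap.coe_mk, AddHom.coe_mk, fderiv_const_mul hg,
    smul_apply, smul_eq_mul]
  ring

theorem contDiffOn_wirt {n : ℕ} {g : Cn n → ℂ} {s : Set (Cn n)} (hs : IsOpen s)
    (hg : ContDiffOn ℝ ∞ g s) (j : Fin n) : ContDiffOn ℝ ∞ (fun y => wirt g y j) s := by
  have h := hg.fderiv_of_isOpen hs (m := ∞) (by simp)
  simp only [wirt, linPart, LinearMap.coe_mk, AddHom.coe_mk]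
  exact ((h.clm_apply contDiffOn_const).sub
    (contDiffOn_const.mul (h.clm_apply contDiffOn_const))).div_const _

theorem contDiffOn_wirtBar {n : ℕ} {g : Cn n → ℂ} {s : Set (Cn n)} (hs : IsOpen s)
    (hg : ContDiffOn ℝ ∞ g s) (j : Fin n) : ContDiffOn ℝ ∞ (fun y => wirtBar g y j) s := by
  have h := hg.fderiv_of_isOpen hs (m := ∞) (by simp)
  simp only [wirtBar, conjPart, LinearMap.coe_mk, AddHom.coe_mk]
  exact ((h.clm_apply contDiffOn_const).add
    (contDiffOn_const.mul (h.clm_apply contDiffOn_const))).div_const _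

/-! ### Frames, tensor fields and their components in holomorphic charts

`M` is a complex manifold modelled on `ℂⁿ`. The complex vector space `TangentSpace 𝓘(ℂ, Cn n) x`
is the holomorphic tangent space `T^{1,0}_x`. A `(0,1)`-covector at `x` is a conjugate linear
functional on it, and an element of `∧² T^{1,0}_x` is an alternating bilinear form on its dual. -/

section Fields

variable {n : ℕ} {M : Type*} [TopologicalSpace M] [ChartedSpace (Cn n) M]

/-- The fibre of the holomorphic tangent bundle `T^{1,0}`. -/
abbrev Tan (n : ℕ) {M : Type*} [TopologicalSpace M] [ChartedSpace (Cn n) M] (x : M) : Type :=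
  TangentSpace 𝓘(ℂ, Cn n) x

/-- The fibre of the bundle `T^{*(0,1)}` of `(0,1)`-forms. -/
abbrev ConjCotan (n : ℕ) {M : Type*} [TopologicalSpace M] [ChartedSpace (Cn n) M] (x : M) :
    Type :=
  Tan n x →ₛₗ[starRingEnd ℂ] ℂ

/-- The fibre of the bundle `T^{2,0} = ∧² T^{1,0}` of bivectors. -/
abbrev Biv (n : ℕ) {M : Type*} [TopologicalSpace M] [ChartedSpace (Cn n) M] (x : M) : Type :=
  (Tan n x →ₗ[ℂ] ℂ) [⋀^Fin 2]→ₗ[ℂ] ℂ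

/-- The coordinate covector `dz_i` at `x` of the chart `φ`. -/
def coframe (φ : OpenPartialHomeomorph M (Cn n)) (x : M) (i : Fin n) : Tan n x →ₗ[ℂ] ℂ :=
  coord i ∘ₗ
    (mfderiv 𝓘(ℂ, Cn n) 𝓘(ℂ, Cn n) φ x : Tan n x →L[ℂ] Cn n).toLinearMap

/-- The coordinate vector `∂/∂z_j` of the chart `φ` at the point with coordinates `y`. -/
def frame (φ : OpenPartialHomeomorph M (Cn n)) (y : Cn n) (j : Fin n) : Tan n (φ.symm y) :=
  (mfderiv 𝓘(ℂ, Cn n) 𝓘(ℂ, Cn n) φ.symm y : Cn n →L[ℂ] Tan n (φ.symm y)) (EuclideanSpace.single j 1)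

/-- The component `Z^i` of `Z = ∑ Z^i ∂/∂z_i` in the chart `φ`. -/
def vecComp (φ : OpenPartialHomeomorph M (Cn n)) (Z : ∀ x : M, Tan n x) (i : Fin n)
    (y : Cn n) : ℂ :=
  coframe φ (φ.symm y) i (Z (φ.symm y))

/-- The component `η_j` of `η = ∑ η_j dz̄_j` in the chart `φ`. -/
def formComp (φ : OpenPartialHomeomorph M (Cn n)) (η : ∀ x : M, ConjCotan n x) (j : Fin n)
    (y : Cn n) : ℂ :=
  η (φ.symm y) (frame φ y j)

/-- The component `Λ^{ij}` of `Λ = ½ ∑ Λ^{ij} ∂/∂z_i ∧ ∂/∂z_j` in the chart `φ`. -/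
def bivComp (φ : OpenPartialHomeomorph M (Cn n)) (Λ : ∀ x : M, Biv n x) (i j : Fin n)
    (y : Cn n) : ℂ :=
  Λ (φ.symm y) ![coframe φ (φ.symm y) i, coframe φ (φ.symm y) j]

end Fields

section Spaces

variable (n : ℕ) (M : Type*) [TopologicalSpace M] [ChartedSpace (Cn n) M]

/-- `C^∞(M)`: complex valued functions that are smooth in the real sense. -/
def SmoothFun : Submodule ℂ (M → ℂ) where
  carrier := {f | ContMDiff 𝓘(ℝ, Cn n) 𝓘(ℝ, ℂ) ∞ f}
  add_mem' := fun hf hg => ContMDiff.add hf hg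
  zero_mem' := contMDiff_const
  smul_mem' := fun c f hf =>
    (ContinuousLinearMap.mul ℝ ℂ c).contMDiff.comp
      (hf : ContMDiff 𝓘(ℝ, Cn n) 𝓘(ℝ, ℂ) ∞ f)

/-- `C^∞(T^{1,0})`: smooth vector fields of type `(1,0)`. -/
def SmoothVec : Submodule ℂ (∀ x : M, Tan n x) where
  carrier := {Z | ∀ φ ∈ atlas (Cn n) M, ∀ i, ContDiffOn ℝ ∞ (vecComp φ Z i) φ.target}
  add_mem' := fun hf hg φ hφ i => by
    refine ((hf φ hφ i).add (hg φ hφ i)).congr fun y _ => ?_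
    simp [vecComp]
  zero_mem' := fun φ hφ i => (contDiffOn_const (c := (0 : ℂ))).congr fun y _ => by simp [vecComp]
  smul_mem' := fun c f hf φ hφ i => by
    refine ((contDiffOn_const (c := c)).mul (hf φ hφ i)).congr fun y _ => ?_
    simp [vecComp]

/-- `C^∞(T^{*(0,1)})`: smooth `(0,1)`-forms. -/
def SmoothForm : Submodule ℂ (∀ x : M, ConjCotan n x) where
  carrier := {η | ∀ φ ∈ atlas (Cn n) M, ∀ j, ContDiffOn ℝ ∞ (formComp φ η j) φ.target}
  add_mem' := fun hf hg φ hφ i => by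
    refine ((hf φ hφ i).add (hg φ hφ i)).congr fun y _ => ?_
    simp [formComp]
  zero_mem' := fun φ hφ i => (contDiffOn_const (c := (0 : ℂ))).congr fun y _ => by simp [formComp]
  smul_mem' := fun c f hf φ hφ i => by
    refine ((contDiffOn_const (c := c)).mul (hf φ hφ i)).congr fun y _ => ?_
    simp [formComp]

/-- `C^∞(T^{2,0})`: smooth bivector fields of type `(2,0)`. -/
def SmoothBiv : Submodule ℂ (∀ x : M, Biv n x) where
  carrier := {Λ | ∀ φ ∈ atlas (Cn n) M, ∀ i j, ContDiffOn ℝ ∞ (bivComp φ Λ i j) φ.target}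
  add_mem' := fun hf hg φ hφ i j => by
    refine ((hf φ hφ i j).add (hg φ hφ i j)).congr fun y _ => ?_
    simp [bivComp]
  zero_mem' := fun φ hφ i j => (contDiffOn_const (c := (0 : ℂ))).congr fun y _ => by simp [bivComp]
  smul_mem' := fun c f hf φ hφ i j => by
    refine ((contDiffOn_const (c := c)).mul (hf φ hφ i j)).congr fun y _ => ?_
    simp [bivComp]

/-- `C^∞(L)` for `L = T^{1,0} ⊕ T^{*(0,1)}`. -/
abbrev SmoothL : Type _ := SmoothVec n M × SmoothForm n M

/-- A chart of the atlas together with (the coordinates of) a point in its domain. A tensor field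
with two indices is given below by its components, as a function on
`ChartPt n M`: one matrix for every chart and every point in the domain of the chart. -/
abbrev ChartPt : Type _ := Σ φ : atlas (Cn n) M, φ.1.target

/-- Families of components with two indices, in all charts at all points. -/
abbrev Comp2 : Type _ := ChartPt n M → Fin n → Fin n → ℂ

end Spaces

section Operators

variable {n : ℕ} {M : Type*} [TopologicalSpace M] [ChartedSpace (Cn n) M]

theorem vec_diffAt (Z : SmoothVec n M) (p : ChartPt n M) (i : Fin n) :
    DifferentiableAt ℝ (vecComp p.1.1 Z.1 i) p.2.1 :=
  ((Z.2 p.1.1 p.1.2 i).contDiffAt (p.1.1.open_target.mem_nhds p.2.2)).differentiableAt (by simp)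

theorem form_diffAt (η : SmoothForm n M) (p : ChartPt n M) (i : Fin n) :
    DifferentiableAt ℝ (formComp p.1.1 η.1 i) p.2.1 :=
  ((η.2 p.1.1 p.1.2 i).contDiffAt (p.1.1.open_target.mem_nhds p.2.2)).differentiableAt (by simp)

theorem vecComp_add (φ : OpenPartialHomeomorph M (Cn n)) (Z W : ∀ x : M, Tan n x) (i : Fin n) :
    vecComp φ (Z + W) i = fun y => vecComp φ Z i y + vecComp φ W i y := by
  funext y; simp [vecComp]

theorem vecComp_smul (φ : OpenPartialHomeomorph M (Cn n)) (c : ℂ) (Z : ∀ x : M, Tan n x)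
    (i : Fin n) : vecComp φ (c • Z) i = fun y => c * vecComp φ Z i y := by
  funext y; simp [vecComp]

theorem formComp_add (φ : OpenPartialHomeomorph M (Cn n)) (Z W : ∀ x : M, ConjCotan n x)
    (i : Fin n) : formComp φ (Z + W) i = fun y => formComp φ Z i y + formComp φ W i y := by
  funext y; simp [formComp]

theorem formComp_smul (φ : OpenPartialHomeomorph M (Cn n)) (c : ℂ) (Z : ∀ x : M, ConjCotan n x)
    (i : Fin n) : formComp φ (c • Z) i = fun y => c * formComp φ Z i y := by
  funext y; simp [formComp]

/-- `∂̄` on `C^∞(T^{1,0})`, with values in `T^{1,0} ⊗ T^{*(0,1)}`: the entry `i j` is the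
coefficient `∂Z^i/∂z̄_j` of `dz̄_j ∧ ∂/∂z_i`. -/
def dbarVec : SmoothVec n M →ₗ[ℂ] Comp2 n M where
  toFun := fun Z p i j => wirtBar (vecComp p.1.1 Z.1 i) p.2.1 j
  map_add' := fun Z W => by
    funext p i j
    simp only [Submodule.coe_add, vecComp_add, Pi.add_apply]
    exact wirtBar_add (vec_diffAt Z p i) (vec_diffAt W p i) j
  map_smul' := fun c Z => by
    funext p i j
    simp only [Submodule.coe_smul, vecComp_smul, Pi.smul_apply]
    exact wirtBar_const_mul (vec_diffAt Z p i) c j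

/-- `∂̄` on `(0,1)`-forms, with values in `T^{*(0,2)}`: the entry `j k` is
`∂η_k/∂z̄_j - ∂η_j/∂z̄_k`. -/
def dbarForm : SmoothForm n M →ₗ[ℂ] Comp2 n M where
  toFun := fun η p j k =>
    wirtBar (formComp p.1.1 η.1 k) p.2.1 j - wirtBar (formComp p.1.1 η.1 j) p.2.1 k
  map_add' := fun Z W => by
    funext p j k
    simp only [Submodule.coe_add, formComp_add, Pi.add_apply]
    rw [wirtBar_add (form_diffAt Z p k) (form_diffAt W p k) j, wirtBar_add (form_diffAt Z p j) (form_diffAt W p j) k]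
    ring
  map_smul' := fun c Z => by
    funext p j k
    simp only [Submodule.coe_smul, formComp_smul, Pi.smul_apply, RingHom.id_apply, smul_eq_mul]
    rw [wirtBar_const_mul (form_diffAt Z p k), wirtBar_const_mul (form_diffAt Z p j)]
    ring

/-- The Schouten bracket `[Λ, Z] = - L_Z Λ` in `T^{2,0}`: the entry `i j` is
`∑_k (Λ^{kj} ∂Z^i/∂z_k + Λ^{ik} ∂Z^j/∂z_k - Z^k ∂Λ^{ij}/∂z_k)`. -/
def schoutenVec (Λ : SmoothBiv n M) : SmoothVec n M →ₗ[ℂ] Comp2 n M where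
  toFun := fun Z p i j => ∑ k,
    (bivComp p.1.1 Λ.1 k j p.2.1 * wirt (vecComp p.1.1 Z.1 i) p.2.1 k
      + bivComp p.1.1 Λ.1 i k p.2.1 * wirt (vecComp p.1.1 Z.1 j) p.2.1 k
      - vecComp p.1.1 Z.1 k p.2.1 * wirt (bivComp p.1.1 Λ.1 i j) p.2.1 k)
  map_add' := fun Z W => by
    funext p i j
    simp only [Submodule.coe_add, vecComp_add, Pi.add_apply, ← Finset.sum_add_distrib]
    refine Finset.sum_congr rfl fun k _ => ?_
    rw [wirt_add (vec_diffAt Z p i) (vec_diffAt W p i) k, wirt_add (vec_diffAt Z p j) (vec_diffAt W p j) k]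
    ring
  map_smul' := fun c Z => by
    funext p i j
    simp only [Submodule.coe_smul, vecComp_smul, Pi.smul_apply, RingHom.id_apply, smul_eq_mul,
      Finset.mul_sum]
    refine Finset.sum_congr rfl fun k _ => ?_
    rw [wirt_const_mul (vec_diffAt Z p i), wirt_const_mul (vec_diffAt Z p j)]
    ring

/-- The Schouten bracket `[Λ, η]` in `T^{1,0} ⊗ T^{*(0,1)}`: from `[X, η] = L_X η` and
`[X ∧ Y, η] = X ∧ [Y, η] + [X, η] ∧ Y` the coefficient of `dz̄_j ∧ ∂/∂z_i` is
`- ∑_k Λ^{ik} ∂η_j/∂z_k`. -/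
def schoutenForm (Λ : SmoothBiv n M) : SmoothForm n M →ₗ[ℂ] Comp2 n M where
  toFun := fun η p i j =>
    - ∑ k, bivComp p.1.1 Λ.1 i k p.2.1 * wirt (formComp p.1.1 η.1 j) p.2.1 k
  map_add' := fun Z W => by
    funext p i j
    simp only [Submodule.coe_add, formComp_add, Pi.add_apply, ← neg_add,
      ← Finset.sum_add_distrib]
    congr 1
    refine Finset.sum_congr rfl fun k _ => ?_
    rw [wirt_add (form_diffAt Z p j) (form_diffAt W p j) k]
    ring
  map_smul' := fun c Z => by
    funext p i j
    simp only [Submodule.coe_smul, formComp_smul, Pi.smul_apply, RingHom.id_apply, smul_eq_mul,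
      Finset.mul_sum, mul_neg]
    congr 1
    refine Finset.sum_congr rfl fun k _ => ?_
    rw [wirt_const_mul (form_diffAt Z p j)]
    ring

/-- `Λ` is a holomorphic Poisson structure: `∂̄Λ = 0` and `[Λ, Λ] = 0`. The bracket `[Λ, Λ]` is
the trivector field with components
`2 ∑_l (Λ^{il} ∂Λ^{jk}/∂z_l + Λ^{jl} ∂Λ^{ki}/∂z_l + Λ^{kl} ∂Λ^{ij}/∂z_l)`. -/
structure IsHolomorphicPoisson (Λ : SmoothBiv n M) : Prop where
  dbar_eq_zero : ∀ (p : ChartPt n M) (i j k : Fin n),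
    wirtBar (bivComp p.1.1 Λ.1 i j) p.2.1 k = 0
  schouten_self_eq_zero : ∀ (p : ChartPt n M) (i j k : Fin n),
    2 * ∑ l, (bivComp p.1.1 Λ.1 i l p.2.1 * wirt (bivComp p.1.1 Λ.1 j k) p.2.1 l
      + bivComp p.1.1 Λ.1 j l p.2.1 * wirt (bivComp p.1.1 Λ.1 k i) p.2.1 l
      + bivComp p.1.1 Λ.1 k l p.2.1 * wirt (bivComp p.1.1 Λ.1 i j) p.2.1 l) = 0

/-- The differential of a smooth function at `x`. -/
def realDeriv (f : M → ℂ) (x : M) : Cn n →L[ℝ] ℂ :=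
  mfderiv 𝓘(ℝ, Cn n) 𝓘(ℝ, ℂ) f x

/-- The `(1,0)`-form `∂f` at `x`. -/
def delAt (n : ℕ) {M : Type*} [TopologicalSpace M] [ChartedSpace (Cn n) M] (f : M → ℂ) (x : M) :
    Tan n x →ₗ[ℂ] ℂ :=
  linPart (realDeriv f x)

/-- The `(0,1)`-form `∂̄f` at `x`. -/
def dbarAt (n : ℕ) {M : Type*} [TopologicalSpace M] [ChartedSpace (Cn n) M] (f : M → ℂ) (x : M) :
    ConjCotan n x :=
  conjPart (realDeriv f x)

/-- The Schouten bracket `[Λ, f]` at `x`: the vector with `α([Λ, f]) = Λ(α, ∂f)` for all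
covectors `α`, in accordance with `[X ∧ Y, f] = Y(f) X - X(f) Y`. The vector is written through
the coordinates on the tangent space at `x`. -/
def schoutenAt (Λ : ∀ x : M, Biv n x) (f : M → ℂ) (x : M) : Tan n x :=
  (WithLp.toLp 2 fun i => Λ x ![coord i, delAt n f x] : Cn n)

/-- The characterization of `[Λ, f]` by its pairing with covectors. -/
theorem apply_schoutenAt (Λ : ∀ x : M, Biv n x) (f : M → ℂ) (x : M) (α : Tan n x →ₗ[ℂ] ℂ) :
    α (schoutenAt Λ f x) = Λ x ![α, delAt n f x] := by
  have h : ∀ (B : (Cn n →ₗ[ℂ] ℂ) [⋀^Fin 2]→ₗ[ℂ] ℂ) (α β : Cn n →ₗ[ℂ] ℂ),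
      α (WithLp.toLp 2 fun i => B ![coord i, β]) = B ![α, β] := by
    intro B α β
    have h1 := alt_left B (fun i => α (EuclideanSpace.single i 1)) (fun i => coord i) β
    rw [← dual_eq_sum α] at h1
    rw [h1, eq_sum_single (WithLp.toLp 2 fun i => B ![coord i, β])]
    simp only [map_sum, map_smul, smul_eq_mul]
    exact Finset.sum_congr rfl fun k _ => mul_comm _ _
  exact h _ _ _

/-- The real manifold underlying a complex manifold. -/
theorem isManifold_real [h : IsManifold 𝓘(ℂ, Cn n) ω M] : IsManifold 𝓘(ℝ, Cn n) ∞ M := by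
  refine isManifold_of_contDiffOn _ _ _ fun e e' he he' => ?_
  have h2 := h.compatible he he'
  rw [contDiffGroupoid, mem_groupoid_of_pregroupoid] at h2
  have h3 : ContDiffOn ℂ ω (𝓘(ℂ, Cn n) ∘ e.symm ≫ₕ e' ∘ 𝓘(ℂ, Cn n).symm)
    (𝓘(ℂ, Cn n).symm ⁻¹' (e.symm ≫ₕ e').source ∩ Set.range 𝓘(ℂ, Cn n)) := h2.1
  exact (h3.of_le le_top).restrict_scalars ℝ

theorem hasFDerivWithinAt_real {F : Cn n → Cn n} {A : Cn n →L[ℂ] Cn n} {s : Set (Cn n)}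
    {y : Cn n} (h : HasFDerivWithinAt F A s y) :
    HasFDerivWithinAt F (A.restrictScalars ℝ) s y :=
  h.restrictScalars ℝ

/-- The derivative of the inverse of the chart `φ`, as an endomorphism of `ℂⁿ`. -/
def symmDeriv (φ : OpenPartialHomeomorph M (Cn n)) (y : Cn n) : Cn n →L[ℂ] Cn n :=
  mfderiv 𝓘(ℂ, Cn n) 𝓘(ℂ, Cn n) φ.symm y

theorem realDeriv_symm [IsManifold 𝓘(ℂ, Cn n) ω M] {f : M → ℂ} (hf : f ∈ SmoothFun n M)
    {φ : OpenPartialHomeomorph M (Cn n)} (hφ : φ ∈ atlas (Cn n) M) {y : Cn n}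
    (hy : y ∈ φ.target) (v : Cn n) :
    realDeriv f (φ.symm y) (symmDeriv φ y v) = fderiv ℝ (f ∘ φ.symm) y v := by
  have h1 : HasMFDerivAt 𝓘(ℂ, Cn n) 𝓘(ℂ, Cn n) φ.symm y (symmDeriv φ y) :=
    (mdifferentiableAt_atlas_symm hφ hy).hasMFDerivAt
  have h12 : HasFDerivWithinAt (writtenInExtChartAt 𝓘(ℂ, Cn n) 𝓘(ℂ, Cn n) y φ.symm)
      (symmDeriv φ y) (Set.range 𝓘(ℂ, Cn n)) (extChartAt 𝓘(ℂ, Cn n) y y) := h1.2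
  have h2 : HasMFDerivAt 𝓘(ℝ, Cn n) 𝓘(ℝ, Cn n) φ.symm y ((symmDeriv φ y).restrictScalars ℝ) :=
    ⟨h1.1, hasFDerivWithinAt_real h12⟩
  have h3 : HasMFDerivAt 𝓘(ℝ, Cn n) 𝓘(ℝ, ℂ) f (φ.symm y) (realDeriv f (φ.symm y)) :=
    (ContMDiff.mdifferentiableAt hf (by simp)).hasMFDerivAt
  have h4 : HasMFDerivAt 𝓘(ℝ, Cn n) 𝓘(ℝ, ℂ) (f ∘ φ.symm) y
      ((realDeriv f (φ.symm y)).comp ((symmDeriv φ y).restrictScalars ℝ)) := h3.comp y h2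
  have h5 : HasFDerivAt (f ∘ φ.symm)
      ((realDeriv f (φ.symm y)).comp ((symmDeriv φ y).restrictScalars ℝ)) y :=
    hasMFDerivAt_iff_hasFDerivAt.1 h4
  rw [h5.fderiv]
  rfl

theorem contDiffOn_comp_symm [IsManifold 𝓘(ℂ, Cn n) ω M] {f : M → ℂ} (hf : f ∈ SmoothFun n M)
    {φ : OpenPartialHomeomorph M (Cn n)} (hφ : φ ∈ atlas (Cn n) M) :
    ContDiffOn ℝ ∞ (f ∘ φ.symm) φ.target := by
  have : IsManifold 𝓘(ℝ, Cn n) ∞ M := isManifold_real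
  have h := contMDiffOn_symm_of_mem_maximalAtlas
    (IsManifold.subset_maximalAtlas (I := 𝓘(ℝ, Cn n)) (n := ∞) hφ)
  exact contMDiffOn_iff_contDiffOn.1 (ContMDiff.comp_contMDiffOn hf h)

/-- In a chart, `∂̄f = ∑_j ∂f/∂z̄_j dz̄_j`. -/
theorem formComp_dbarAt [IsManifold 𝓘(ℂ, Cn n) ω M] {f : M → ℂ} (hf : f ∈ SmoothFun n M)
    {φ : OpenPartialHomeomorph M (Cn n)} (hφ : φ ∈ atlas (Cn n) M) {y : Cn n}
    (hy : y ∈ φ.target) (j : Fin n) :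
    formComp φ (dbarAt n f) j y = wirtBar (f ∘ φ.symm) y j :=
  conjPart_comp _ _ (symmDeriv φ y) (realDeriv_symm hf hφ hy) _

theorem delAt_symmDeriv [IsManifold 𝓘(ℂ, Cn n) ω M] {f : M → ℂ} (hf : f ∈ SmoothFun n M)
    {φ : OpenPartialHomeomorph M (Cn n)} (hφ : φ ∈ atlas (Cn n) M) {y : Cn n}
    (hy : y ∈ φ.target) (v : Cn n) :
    delAt n f (φ.symm y) (symmDeriv φ y v) = linPart (fderiv ℝ (f ∘ φ.symm) y) v :=
  linPart_comp _ _ (symmDeriv φ y) (realDeriv_symm hf hφ hy) _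

/-- In a chart, `∂f = ∑_k ∂f/∂z_k dz_k`. -/
theorem delAt_eq_sum [IsManifold 𝓘(ℂ, Cn n) ω M] {f : M → ℂ} (hf : f ∈ SmoothFun n M)
    {φ : OpenPartialHomeomorph M (Cn n)} (hφ : φ ∈ atlas (Cn n) M) {y : Cn n}
    (hy : y ∈ φ.target) :
    delAt n f (φ.symm y) = ∑ k, wirt (f ∘ φ.symm) y k • coframe φ (φ.symm y) k := by
  have hd : φ.MDifferentiable 𝓘(ℂ, Cn n) 𝓘(ℂ, Cn n) := mdifferentiable_of_mem_atlas hφ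
  have hx : φ.symm y ∈ φ.source := φ.map_target hy
  refine LinearMap.ext fun v => ?_
  have h := DFunLike.congr_fun (hd.symm_comp_deriv hx) v
  rw [φ.right_inv hy] at h
  let u : Cn n := (mfderiv 𝓘(ℂ, Cn n) 𝓘(ℂ, Cn n) φ (φ.symm y) : Tan n (φ.symm y) →L[ℂ] Cn n) v
  have hv : symmDeriv φ y u = v := h
  conv_lhs => rw [← hv]
  rw [delAt_symmDeriv hf hφ hy, dual_eq_sum (linPart _), LinearMap.sum_apply,
    LinearMap.sum_apply]
  rfl

/-- In a chart, `[Λ, f] = ∑_i (∑_k Λ^{ik} ∂f/∂z_k) ∂/∂z_i`. -/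
theorem vecComp_schoutenAt [IsManifold 𝓘(ℂ, Cn n) ω M] (Λ : ∀ x : M, Biv n x) {f : M → ℂ}
    (hf : f ∈ SmoothFun n M)
    {φ : OpenPartialHomeomorph M (Cn n)} (hφ : φ ∈ atlas (Cn n) M) {y : Cn n}
    (hy : y ∈ φ.target) (i : Fin n) :
    vecComp φ (schoutenAt Λ f) i y = ∑ k, bivComp φ Λ i k y * wirt (f ∘ φ.symm) y k := by
  rw [vecComp, apply_schoutenAt, delAt_eq_sum hf hφ hy, alt_right]
  exact Finset.sum_congr rfl fun k _ => mul_comm (wirt (f ∘ φ.symm) y k) (bivComp φ Λ i k y)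

theorem realDeriv_add {f g : M → ℂ} (hf : f ∈ SmoothFun n M) (hg : g ∈ SmoothFun n M) (x : M) :
    (realDeriv (f + g) x : Cn n →L[ℝ] ℂ) = realDeriv f x + realDeriv g x :=
  ((ContMDiff.mdifferentiableAt hf (by simp)).hasMFDerivAt.add
    (ContMDiff.mdifferentiableAt hg (by simp)).hasMFDerivAt).mfderiv

theorem realDeriv_smul (c : ℂ) {f : M → ℂ} (hf : f ∈ SmoothFun n M) (x : M) :
    (realDeriv (c • f) x : Cn n →L[ℝ] ℂ) = c • realDeriv f x := by
  have h : HasMFDerivAt 𝓘(ℝ, Cn n) 𝓘(ℝ, ℂ) f x (realDeriv f x) :=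
    (ContMDiff.mdifferentiableAt hf (by simp)).hasMFDerivAt
  have h2 : HasMFDerivAt 𝓘(ℝ, ℂ) 𝓘(ℝ, ℂ) (fun z : ℂ => c * z) (f x)
      (ContinuousLinearMap.mul ℝ ℂ c) := (ContinuousLinearMap.mul ℝ ℂ c).hasMFDerivAt
  exact (h2.comp x h).mfderiv

/-- `∂̄ : C^∞(M) → C^∞(T^{*(0,1)})`. -/
def dbarFun [IsManifold 𝓘(ℂ, Cn n) ω M] : SmoothFun n M →ₗ[ℂ] SmoothForm n M where
  toFun := fun f => ⟨dbarAt n f.1, fun φ hφ j =>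
    (contDiffOn_wirtBar φ.open_target (contDiffOn_comp_symm f.2 hφ) j).congr
      fun _ hy => formComp_dbarAt f.2 hφ hy j⟩
  map_add' := fun f g => Subtype.ext <| funext fun x =>
    (congrArg conjPart (realDeriv_add f.2 g.2 x)).trans (conjPart_add _ _)
  map_smul' := fun c f => Subtype.ext <| funext fun x =>
    (congrArg conjPart (realDeriv_smul c f.2 x)).trans (conjPart_smul _ _)

theorem schoutenAt_add (Λ : ∀ x : M, Biv n x) {f g : M → ℂ} (hf : f ∈ SmoothFun n M)
    (hg : g ∈ SmoothFun n M) (x : M) :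
    schoutenAt Λ (f + g) x = schoutenAt Λ f x + schoutenAt Λ g x := by
  have h : delAt n (f + g) x = delAt n f x + delAt n g x :=
    (congrArg linPart (realDeriv_add hf hg x)).trans (linPart_add _ _)
  refine PiLp.ext fun i => ?_
  have h1 := alt_right (Λ x) ![1, 1] ![delAt n f x, delAt n g x]
    (coord i)
  simp only [Fin.sum_univ_two, Matrix.cons_val_zero, Matrix.cons_val_one, one_smul, one_mul,
    ← h] at h1
  exact h1

theorem schoutenAt_smul (Λ : ∀ x : M, Biv n x) (c : ℂ) {f : M → ℂ} (hf : f ∈ SmoothFun n M)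
    (x : M) : schoutenAt Λ (c • f) x = c • schoutenAt Λ f x := by
  have h : delAt n (c • f) x = c • delAt n f x :=
    (congrArg linPart (realDeriv_smul c hf x)).trans (linPart_smul _ _)
  refine PiLp.ext fun i => ?_
  have h1 := alt_right (Λ x) ![c] ![delAt n f x] (coord i)
  simp only [Fin.sum_univ_one, Matrix.cons_val_zero, ← h] at h1
  exact h1

/-- `[Λ, -] : C^∞(M) → C^∞(T^{1,0})`. -/
def schoutenFun [IsManifold 𝓘(ℂ, Cn n) ω M] (Λ : SmoothBiv n M) :
    SmoothFun n M →ₗ[ℂ] SmoothVec n M where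
  toFun := fun f => ⟨schoutenAt Λ.1 f.1, fun φ hφ i =>
    (ContDiffOn.sum (s := Finset.univ) fun k _ => (Λ.2 φ hφ i k).mul
      (contDiffOn_wirt φ.open_target (contDiffOn_comp_symm f.2 hφ) k)).congr
      fun _ hy => vecComp_schoutenAt Λ.1 f.2 hφ hy i⟩
  map_add' := fun f g => Subtype.ext <| funext fun x => schoutenAt_add Λ.1 f.2 g.2 x
  map_smul' := fun c f => Subtype.ext <| funext fun x => schoutenAt_smul Λ.1 c f.2 x

end Operators

/-! ### Cohomology of a pair of linear maps -/

section Cohomology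

variable {A B C : Type*} [AddCommGroup A] [Module ℂ A] [AddCommGroup B] [Module ℂ B]
  [AddCommGroup C] [Module ℂ C]

/-- The cohomology `ker d₁ / im d₀` of `d₀ : A → B` and `d₁ : B → C`. -/
def Cohomology (d₀ : A →ₗ[ℂ] B) (d₁ : B →ₗ[ℂ] C) : Type _ :=
  LinearMap.ker d₁ ⧸ (LinearMap.range d₀).submoduleOf (LinearMap.ker d₁)

instance (d₀ : A →ₗ[ℂ] B) (d₁ : B →ₗ[ℂ] C) : AddCommGroup (Cohomology d₀ d₁) :=
  inferInstanceAs
    (AddCommGroup (LinearMap.ker d₁ ⧸ (LinearMap.range d₀).submoduleOf (LinearMap.ker d₁)))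

instance (d₀ : A →ₗ[ℂ] B) (d₁ : B →ₗ[ℂ] C) : Module ℂ (Cohomology d₀ d₁) :=
  inferInstanceAs
    (Module ℂ (LinearMap.ker d₁ ⧸ (LinearMap.range d₀).submoduleOf (LinearMap.ker d₁)))

/-- The cohomology class of a cocycle. -/
def cohomologyClass (d₀ : A →ₗ[ℂ] B) (d₁ : B →ₗ[ℂ] C) (b : B) (hb : d₁ b = 0) :
    Cohomology d₀ d₁ :=
  Submodule.Quotient.mk ⟨b, LinearMap.mem_ker.2 hb⟩

end Cohomology

/-! ### The complex of `∂̄_Λ = ∂̄ + [Λ, -]` in degrees `0, 1, 2`, and Dolbeault cohomology -/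

section Complex

variable {n : ℕ} {M : Type*} [TopologicalSpace M] [ChartedSpace (Cn n) M]

variable (n M) in
/-- Components of sections of `∧² L = T^{2,0} ⊕ (T^{1,0} ⊗ T^{*(0,1)}) ⊕ T^{*(0,2)}`. -/
abbrev WedgeComp : Type _ := Comp2 n M × Comp2 n M × Comp2 n M

/-- `∂̄` on `C^∞(L)`: `Z + η ↦ 0 + ∂̄Z + ∂̄η`. -/
def dbarOne : SmoothL n M →ₗ[ℂ] WedgeComp n M :=
  LinearMap.prod 0
    (LinearMap.prod (dbarVec ∘ₗ LinearMap.fst ℂ _ _) (dbarForm ∘ₗ LinearMap.snd ℂ _ _))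

/-- `[Λ, -]` on `C^∞(L)`: `Z + η ↦ [Λ, Z] + [Λ, η] + 0`. -/
def schoutenOne (Λ : SmoothBiv n M) : SmoothL n M →ₗ[ℂ] WedgeComp n M :=
  LinearMap.prod (schoutenVec Λ ∘ₗ LinearMap.fst ℂ _ _)
    (LinearMap.prod (schoutenForm Λ ∘ₗ LinearMap.snd ℂ _ _) 0)

/-- `∂̄_Λ = ∂̄ + [Λ, -]` on `C^∞(L)`. -/
def dbarLambdaOne (Λ : SmoothBiv n M) : SmoothL n M →ₗ[ℂ] WedgeComp n M :=
  dbarOne + schoutenOne Λ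

/-- The space of holomorphic vector fields `W ∈ H⁰(M, T^{1,0})`, i.e. `∂̄W = 0`, that
satisfy `[Λ, W] = 0`. -/
def poissonFields (Λ : SmoothBiv n M) : Submodule ℂ (SmoothVec n M) :=
  LinearMap.ker dbarVec ⊓ LinearMap.ker (schoutenVec Λ)

variable [IsManifold 𝓘(ℂ, Cn n) ω M]

/-- `∂̄` on `C^∞(M)` with values in `C^∞(L)`: `f ↦ 0 + ∂̄f`. -/
def dbarZero : SmoothFun n M →ₗ[ℂ] SmoothL n M :=
  LinearMap.inr ℂ _ _ ∘ₗ dbarFun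

/-- `[Λ, -]` on `C^∞(M)` with values in `C^∞(L)`: `f ↦ [Λ, f] + 0`. -/
def schoutenZero (Λ : SmoothBiv n M) : SmoothFun n M →ₗ[ℂ] SmoothL n M :=
  LinearMap.inl ℂ _ _ ∘ₗ schoutenFun Λ

/-- `∂̄_Λ = ∂̄ + [Λ, -]` on `C^∞(M)`. -/
def dbarLambdaZero (Λ : SmoothBiv n M) : SmoothFun n M →ₗ[ℂ] SmoothL n M :=
  dbarZero + schoutenZero Λ

/-- The first cohomology of `∂̄_Λ`: the kernel of `∂̄_Λ` on `C^∞(L)` modulo the image of `∂̄_Λ`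
on `C^∞(M)`. -/
abbrev H1Lambda (Λ : SmoothBiv n M) : Type _ :=
  Cohomology (dbarLambdaZero Λ) (dbarLambdaOne Λ)

variable (n M) in
/-- The Dolbeault cohomology `H¹(M, 𝒪)`: smooth `∂̄`-closed `(0,1)`-forms modulo `∂̄f` for smooth
functions `f`. -/
abbrev DolbeaultH1 : Type _ :=
  Cohomology (dbarFun : SmoothFun n M →ₗ[ℂ] SmoothForm n M)
    (dbarForm : SmoothForm n M →ₗ[ℂ] Comp2 n M)

end Complex

end HolPoisson

end

noncomputable section

namespace HolPoisson

/-! ### Products and second order Wirtinger derivatives -/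

section Wirtinger

variable {n : ℕ}

/-! By type, `∂̄_Λ(Z, η)` is the triple `[Λ, Z]`, `∂̄Z + [Λ, η]`, `∂̄η`. Hence a pair `(W, 0)` is
closed exactly when `W` is a holomorphic field commuting with `Λ`, and `W ↦ [(W, 0)]` is well
defined.

Surjectivity: in a cocycle `(Z, η)` the form `η` is `∂̄`-closed, so `η = ∂̄f` because `H¹(M, 𝒪) =
0`. Subtracting `∂̄_Λ f` leaves `(Z - [Λ, f], 0)`, which is still closed since `∂̄_Λ² f = 0`. That
identity (`dbarLambdaOne_dbarLambdaZero`) has three parts: `∂̄² f = 0` by symmetry of second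
derivatives, the mixed part by `∂̄Λ = 0` (`dbarVec_schoutenFun`), and `[Λ, [Λ, f]] = 0` by the
Jacobi identity `[Λ, Λ] = 0` (`schoutenVec_schoutenFun`).

Injectivity: if `(W, 0) = ∂̄_Λ f`, then `f` is holomorphic on a compact manifold, hence locally
constant, so `W = [Λ, f] = 0` (`schoutenFun_eq_zero`). -/

theorem wirt_mul {g h : Cn n → ℂ} {y : Cn n} (hg : DifferentiableAt ℝ g y)
    (hh : DifferentiableAt ℝ h y) (j : Fin n) :
    wirt (fun z => g z * h z) y j = g y * wirt h y j + h y * wirt g y j := by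
  simp only [wirt, linPart, LinearMap.coe_mk, AddHom.coe_mk, fderiv_fun_mul hg hh,
    add_apply, smul_apply, smul_eq_mul]
  ring

theorem wirtBar_mul {g h : Cn n → ℂ} {y : Cn n} (hg : DifferentiableAt ℝ g y)
    (hh : DifferentiableAt ℝ h y) (j : Fin n) :
    wirtBar (fun z => g z * h z) y j = g y * wirtBar h y j + h y * wirtBar g y j := by
  simp only [wirtBar, conjPart, LinearMap.coe_mk, AddHom.coe_mk, fderiv_fun_mul hg hh,
    add_apply, smul_apply, smul_eq_mul]
  ring

theorem wirt_sum {ι : Type*} (s : Finset ι) {g : ι → Cn n → ℂ} {y : Cn n}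
    (hg : ∀ k ∈ s, DifferentiableAt ℝ (g k) y) (j : Fin n) :
    wirt (fun z => ∑ k ∈ s, g k z) y j = ∑ k ∈ s, wirt (g k) y j := by
  simp only [wirt, linPart, LinearMap.coe_mk, AddHom.coe_mk, fderiv_fun_sum hg,
    sum_apply, Finset.mul_sum, ← Finset.sum_sub_distrib, Finset.sum_div]

theorem wirtBar_sum {ι : Type*} (s : Finset ι) {g : ι → Cn n → ℂ} {y : Cn n}
    (hg : ∀ k ∈ s, DifferentiableAt ℝ (g k) y) (j : Fin n) :
    wirtBar (fun z => ∑ k ∈ s, g k z) y j = ∑ k ∈ s, wirtBar (g k) y j := by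
  simp only [wirtBar, conjPart, LinearMap.coe_mk, AddHom.coe_mk, fderiv_fun_sum hg,
    sum_apply, Finset.mul_sum, ← Finset.sum_add_distrib, Finset.sum_div]

/-- The coordinate formulas for `∂̄f` and `[Λ, f]` hold only on the target of a chart. A Wirtinger
derivative depends only on the germ, so openness of the target allows them to be substituted before
differentiating. -/
theorem wirt_congr {g h : Cn n → ℂ} {s : Set (Cn n)} (hs : IsOpen s) (hgh : Set.EqOn g h s)
    {y : Cn n} (hy : y ∈ s) (j : Fin n) : wirt g y j = wirt h y j := by
  rw [wirt, wirt, (hgh.eventuallyEq_of_mem (hs.mem_nhds hy)).fderiv_eq]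

theorem wirtBar_congr {g h : Cn n → ℂ} {s : Set (Cn n)} (hs : IsOpen s) (hgh : Set.EqOn g h s)
    {y : Cn n} (hy : y ∈ s) (j : Fin n) : wirtBar g y j = wirtBar h y j := by
  rw [wirtBar, wirtBar, (hgh.eventuallyEq_of_mem (hs.mem_nhds hy)).fderiv_eq]

/-- A Wirtinger derivative is a fixed combination of two evaluations of `fderiv ℝ g`, so
differentiation passes inside. This reduces iterated Wirtinger derivatives to the real second
derivative. -/
theorem fderiv_wirt {g : Cn n → ℂ} {y : Cn n} (hg : DifferentiableAt ℝ (fderiv ℝ g) y)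
    (j : Fin n) (u : Cn n) :
    fderiv ℝ (fun z => wirt g z j) y u = linPart (fderiv ℝ (fderiv ℝ g) y u)
      (EuclideanSpace.single j 1) := by
  have h (v : Cn n) := hg.hasFDerivAt.clm_apply (hasFDerivAt_const v y)
  have h2 := ((h (EuclideanSpace.single j 1)).sub
    ((h (Complex.I • EuclideanSpace.single j 1)).const_mul Complex.I)).mul_const (2⁻¹ : ℂ)
  -- Division by 2 in `linPart` unfolds to multiplication by `2⁻¹`, so `h2` already proves this.
  have h3 : HasFDerivAt (fun z => wirt g z j) _ y := h2
  rw [h3.fderiv]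
  simp [linPart, div_eq_mul_inv, mul_comm]

theorem fderiv_wirtBar {g : Cn n → ℂ} {y : Cn n} (hg : DifferentiableAt ℝ (fderiv ℝ g) y)
    (j : Fin n) (u : Cn n) :
    fderiv ℝ (fun z => wirtBar g z j) y u = conjPart (fderiv ℝ (fderiv ℝ g) y u)
      (EuclideanSpace.single j 1) := by
  have h (v : Cn n) := hg.hasFDerivAt.clm_apply (hasFDerivAt_const v y)
  have h2 := ((h (EuclideanSpace.single j 1)).add
    ((h (Complex.I • EuclideanSpace.single j 1)).const_mul Complex.I)).mul_const (2⁻¹ : ℂ)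
  have h3 : HasFDerivAt (fun z => wirtBar g z j) _ y := h2
  rw [h3.fderiv]
  simp [conjPart, div_eq_mul_inv, mul_comm, mul_add]

theorem differentiableAt_fderiv {g : Cn n → ℂ} {y : Cn n} (hg : ContDiffAt ℝ ∞ g y) :
    DifferentiableAt ℝ (fderiv ℝ g) y :=
  (hg.fderiv_right (m := ∞) (by simp)).differentiableAt (by simp)

theorem fderiv_fderiv_comm {g : Cn n → ℂ} {y : Cn n} (hg : ContDiffAt ℝ ∞ g y) (u v : Cn n) :
    fderiv ℝ (fderiv ℝ g) y u v = fderiv ℝ (fderiv ℝ g) y v u :=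
  hg.isSymmSndFDerivAt
    -- Over `ℝ` symmetry of the second derivative needs only class `C²`, and `2 ≤ ∞`.
    (minSmoothness_of_isRCLikeNormedField.le.trans (WithTop.coe_le_coe.2 le_top)) u v

/-- Both sides expand into values of the real second derivative on the four pairs formed from `e_j`,
`i e_j` and `e_k`, `i e_k`; its symmetry matches them. The two variants below differ only in signs.
-/
theorem wirt_wirt_comm {g : Cn n → ℂ} {y : Cn n} (hg : ContDiffAt ℝ ∞ g y) (j k : Fin n) :
    wirt (fun z => wirt g z j) y k = wirt (fun z => wirt g z k) y j := by
  have hd := differentiableAt_fderiv hg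
  have hc := fderiv_fderiv_comm hg
  rw [wirt, wirt]
  simp only [linPart, LinearMap.coe_mk, AddHom.coe_mk, fderiv_wirt hd]
  rw [hc (EuclideanSpace.single k 1) (EuclideanSpace.single j 1),
    hc (EuclideanSpace.single k 1) (Complex.I • EuclideanSpace.single j 1),
    hc (Complex.I • EuclideanSpace.single k 1) (EuclideanSpace.single j 1),
    hc (Complex.I • EuclideanSpace.single k 1) (Complex.I • EuclideanSpace.single j 1)]
  ring

theorem wirtBar_wirtBar_comm {g : Cn n → ℂ} {y : Cn n} (hg : ContDiffAt ℝ ∞ g y)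
    (j k : Fin n) :
    wirtBar (fun z => wirtBar g z j) y k = wirtBar (fun z => wirtBar g z k) y j := by
  have hd := differentiableAt_fderiv hg
  have hc := fderiv_fderiv_comm hg
  rw [wirtBar, wirtBar]
  simp only [conjPart, LinearMap.coe_mk, AddHom.coe_mk, fderiv_wirtBar hd]
  rw [hc (EuclideanSpace.single k 1) (EuclideanSpace.single j 1),
    hc (EuclideanSpace.single k 1) (Complex.I • EuclideanSpace.single j 1),
    hc (Complex.I • EuclideanSpace.single k 1) (EuclideanSpace.single j 1),
    hc (Complex.I • EuclideanSpace.single k 1) (Complex.I • EuclideanSpace.single j 1)]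
  ring

theorem wirtBar_wirt_comm {g : Cn n → ℂ} {y : Cn n} (hg : ContDiffAt ℝ ∞ g y) (j k : Fin n) :
    wirtBar (fun z => wirt g z j) y k = wirt (fun z => wirtBar g z k) y j := by
  have hd := differentiableAt_fderiv hg
  have hc := fderiv_fderiv_comm hg
  rw [wirtBar, wirt]
  simp only [linPart, conjPart, LinearMap.coe_mk, AddHom.coe_mk, fderiv_wirt hd,
    fderiv_wirtBar hd]
  rw [hc (EuclideanSpace.single k 1) (EuclideanSpace.single j 1),
    hc (EuclideanSpace.single k 1) (Complex.I • EuclideanSpace.single j 1),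
    hc (Complex.I • EuclideanSpace.single k 1) (EuclideanSpace.single j 1),
    hc (Complex.I • EuclideanSpace.single k 1) (Complex.I • EuclideanSpace.single j 1)]
  ring

end Wirtinger

/-! ### The square of `∂̄_Λ` vanishes on functions -/

section Square

variable {n : ℕ} {M : Type*} [TopologicalSpace M] [ChartedSpace (Cn n) M]

theorem bivComp_swap (φ : OpenPartialHomeomorph M (Cn n)) (Λ : ∀ x : M, Biv n x) (i j : Fin n)
    (y : Cn n) : bivComp φ Λ j i y = -bivComp φ Λ i j y := by
  have h := (Λ (φ.symm y)).map_swap ![coframe φ (φ.symm y) i, coframe φ (φ.symm y) j]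
    (i := 0) (j := 1) (by simp)
  rw [bivComp, bivComp, ← h]
  congr 1
  ext k : 1
  fin_cases k <;> simp

theorem wirt_bivComp_swap (φ : OpenPartialHomeomorph M (Cn n)) (Λ : ∀ x : M, Biv n x)
    (i j k : Fin n) (y : Cn n) :
    wirt (bivComp φ Λ j i) y k = -wirt (bivComp φ Λ i j) y k := by
  have h : bivComp φ Λ j i = -bivComp φ Λ i j := funext fun z => bivComp_swap φ Λ i j z
  rw [h]
  simp only [wirt, linPart, LinearMap.coe_mk, AddHom.coe_mk, fderiv_neg, neg_apply]
  ring

theorem biv_diffAt (Λ : SmoothBiv n M) (p : ChartPt n M) (i j : Fin n) :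
    DifferentiableAt ℝ (bivComp p.1.1 Λ.1 i j) p.2.1 :=
  ((Λ.2 p.1.1 p.1.2 i j).contDiffAt (p.1.1.open_target.mem_nhds p.2.2)).differentiableAt (by simp)

variable [IsManifold 𝓘(ℂ, Cn n) ω M]

theorem contDiffAt_comp_symm (f : SmoothFun n M) (p : ChartPt n M) :
    ContDiffAt ℝ ∞ (f.1 ∘ p.1.1.symm) p.2.1 :=
  (contDiffOn_comp_symm f.2 p.1.2).contDiffAt (p.1.1.open_target.mem_nhds p.2.2)

theorem wirt_diffAt (f : SmoothFun n M) (p : ChartPt n M) (i : Fin n) :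
    DifferentiableAt ℝ (fun z => wirt (f.1 ∘ p.1.1.symm) z i) p.2.1 :=
  ((contDiffOn_wirt p.1.1.open_target (contDiffOn_comp_symm f.2 p.1.2) i).contDiffAt
    (p.1.1.open_target.mem_nhds p.2.2)).differentiableAt (by simp)

theorem formComp_dbarFun_eqOn (f : SmoothFun n M) (p : ChartPt n M) (j : Fin n) :
    Set.EqOn (formComp p.1.1 (dbarFun f).1 j) (fun z => wirtBar (f.1 ∘ p.1.1.symm) z j)
      p.1.1.target :=
  fun _ hy => formComp_dbarAt f.2 p.1.2 hy j

theorem vecComp_schoutenFun_eqOn (Λ : SmoothBiv n M) (f : SmoothFun n M) (p : ChartPt n M)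
    (i : Fin n) :
    Set.EqOn (vecComp p.1.1 (schoutenFun Λ f).1 i)
      (fun z => ∑ k, bivComp p.1.1 Λ.1 i k z * wirt (f.1 ∘ p.1.1.symm) z k) p.1.1.target :=
  fun _ hy => vecComp_schoutenAt Λ.1 f.2 p.1.2 hy i

theorem dbarForm_dbarFun (f : SmoothFun n M) : dbarForm (dbarFun f) = 0 := by
  funext p j k
  change wirtBar (formComp p.1.1 (dbarFun f).1 k) p.2.1 j
    - wirtBar (formComp p.1.1 (dbarFun f).1 j) p.2.1 k = 0
  rw [wirtBar_congr p.1.1.open_target (formComp_dbarFun_eqOn f p k) p.2.2,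
    wirtBar_congr p.1.1.open_target (formComp_dbarFun_eqOn f p j) p.2.2,
    wirtBar_wirtBar_comm (contDiffAt_comp_symm f p), sub_self]

/-- If `∂̄Λ = 0`, then `∂̄[Λ, f] + [Λ, ∂̄f] = 0`. -/
theorem dbarVec_schoutenFun {Λ : SmoothBiv n M} (hΛ : IsHolomorphicPoisson Λ)
    (f : SmoothFun n M) : dbarVec (schoutenFun Λ f) + schoutenForm Λ (dbarFun f) = 0 := by
  funext p i j
  change wirtBar (vecComp p.1.1 (schoutenFun Λ f).1 i) p.2.1 j
    + -∑ k, bivComp p.1.1 Λ.1 i k p.2.1 * wirt (formComp p.1.1 (dbarFun f).1 j) p.2.1 k = 0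
  rw [wirtBar_congr p.1.1.open_target (vecComp_schoutenFun_eqOn Λ f p i) p.2.2,
    wirtBar_sum _ fun k _ => (biv_diffAt Λ p i k).fun_mul (wirt_diffAt f p k), add_neg_eq_zero]
  refine Finset.sum_congr rfl fun k _ => ?_
  -- The product rule gives `Λ^{ik} ∂̄_j ∂_k f + ∂_k f · ∂̄_j Λ^{ik}`. The last term vanishes
  -- because `Λ` is holomorphic, and the first is the summand of `-[Λ, ∂̄f]` once `∂̄_j` and `∂_k`
  -- are exchanged.
  rw [wirtBar_mul (biv_diffAt Λ p i k) (wirt_diffAt f p k), hΛ.dbar_eq_zero, mul_zero, add_zero,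
    wirt_congr p.1.1.open_target (formComp_dbarFun_eqOn f p j) p.2.2,
    wirtBar_wirt_comm (contDiffAt_comp_symm f p)]

/-- Separates the second derivatives of `f` from the first ones: in `[Λ, [Λ, f]]` the two groups
cancel for different reasons. -/
theorem wirt_vecComp_schoutenFun (Λ : SmoothBiv n M) (f : SmoothFun n M) (p : ChartPt n M)
    (i k : Fin n) :
    wirt (vecComp p.1.1 (schoutenFun Λ f).1 i) p.2.1 k =
      ∑ l, (bivComp p.1.1 Λ.1 i l p.2.1
          * wirt (fun z => wirt (f.1 ∘ p.1.1.symm) z l) p.2.1 k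
        + wirt (f.1 ∘ p.1.1.symm) p.2.1 l * wirt (bivComp p.1.1 Λ.1 i l) p.2.1 k) := by
  rw [wirt_congr p.1.1.open_target (vecComp_schoutenFun_eqOn Λ f p i) p.2.2,
    wirt_sum _ fun l _ => (biv_diffAt Λ p i l).fun_mul (wirt_diffAt f p l)]
  exact Finset.sum_congr rfl fun l _ => wirt_mul (biv_diffAt Λ p i l) (wirt_diffAt f p l) k

/-- If `[Λ, Λ] = 0`, then `[Λ, [Λ, f]] = 0`. -/
theorem schoutenVec_schoutenFun {Λ : SmoothBiv n M} (hΛ : IsHolomorphicPoisson Λ)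
    (f : SmoothFun n M) : schoutenVec Λ (schoutenFun Λ f) = 0 := by
  funext p i j
  change ∑ k, (bivComp p.1.1 Λ.1 k j p.2.1 * wirt (vecComp p.1.1 (schoutenFun Λ f).1 i) p.2.1 k
      + bivComp p.1.1 Λ.1 i k p.2.1 * wirt (vecComp p.1.1 (schoutenFun Λ f).1 j) p.2.1 k
      - vecComp p.1.1 (schoutenFun Λ f).1 k p.2.1 * wirt (bivComp p.1.1 Λ.1 i j) p.2.1 k) = 0
  simp only [wirt_vecComp_schoutenFun, vecComp_schoutenFun_eqOn Λ f p _ p.2.2]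
  -- The Jacobi identity with third index `l` free, to be contracted with `∂f/∂z_l`.
  have hJ (l : Fin n) : ∑ k, (bivComp p.1.1 Λ.1 i k p.2.1 * wirt (bivComp p.1.1 Λ.1 j l) p.2.1 k
      + bivComp p.1.1 Λ.1 j k p.2.1 * wirt (bivComp p.1.1 Λ.1 l i) p.2.1 k
      + bivComp p.1.1 Λ.1 l k p.2.1 * wirt (bivComp p.1.1 Λ.1 i j) p.2.1 k) = 0 := by
    simpa using hΛ.schouten_self_eq_zero p i j l
  have hS (k l : Fin n) := wirt_wirt_comm (contDiffAt_comp_symm f p) k l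
  have hA (k l : Fin n) := bivComp_swap p.1.1 Λ.1 k l p.2.1
  have hB (k l m : Fin n) := wirt_bivComp_swap p.1.1 Λ.1 k l m p.2.1
  -- What remains is algebra of finite sums: `b` stands for `Λ`, `d` for its derivatives, `s` for
  -- the Hessian and `t` for the gradient of `f`.
  set b : Fin n → Fin n → ℂ := fun k l => bivComp p.1.1 Λ.1 k l p.2.1
  set d : Fin n → Fin n → Fin n → ℂ := fun k l m => wirt (bivComp p.1.1 Λ.1 k l) p.2.1 m
  set s : Fin n → Fin n → ℂ := fun l k => wirt (fun z => wirt (f.1 ∘ p.1.1.symm) z l) p.2.1 k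
  set t : Fin n → ℂ := fun l => wirt (f.1 ∘ p.1.1.symm) p.2.1 l
  change ∀ l, ∑ k, (b i k * d j l k + b j k * d l i k + b l k * d i j k) = 0 at hJ
  change ∀ k l, s k l = s l k at hS
  change ∀ k l, b l k = -b k l at hA
  change ∀ k l m, d l k m = -d k l m at hB
  change ∑ k, (b k j * ∑ l, (b i l * s l k + t l * d i l k)
    + b i k * ∑ l, (b j l * s l k + t l * d j l k) - (∑ l, b k l * t l) * d i j k) = 0
  -- The Hessian terms cancel without Jacobi: exchange the summation indices, then use that `s` is
  -- symmetric and `b` antisymmetric.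
  have hcross : ∑ k, ∑ l, b i k * (b j l * s l k) = -∑ k, ∑ l, b k j * (b i l * s l k) := by
    rw [Finset.sum_comm, ← Finset.sum_neg_distrib]
    refine Finset.sum_congr rfl fun k _ => ?_
    rw [← Finset.sum_neg_distrib]
    refine Finset.sum_congr rfl fun l _ => ?_
    rw [hA j k, hS k l]
    ring
  calc _ = (∑ k, ∑ l, b k j * (b i l * s l k)) + (∑ k, ∑ l, b i k * (b j l * s l k))
        + ∑ k, ∑ l, t l * (b i k * d j l k + b j k * d l i k + b l k * d i j k) := by
        simp only [← Finset.sum_add_distrib, Finset.mul_sum, Finset.sum_mul,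
          ← Finset.sum_sub_distrib]
        refine Finset.sum_congr rfl fun k _ => Finset.sum_congr rfl fun l _ => ?_
        -- These sign changes identify the gradient terms with the cyclic sum of `hJ`.
        rw [hA j k, hA k l, hB i l]
        ring
    _ = 0 := by
        rw [hcross, add_neg_cancel, zero_add, Finset.sum_comm]
        simp only [← Finset.mul_sum, hJ, mul_zero, Finset.sum_const_zero]

/-- `∂̄_Λ ∘ ∂̄_Λ = 0` on functions. -/
theorem dbarLambdaOne_dbarLambdaZero {Λ : SmoothBiv n M} (hΛ : IsHolomorphicPoisson Λ)
    (f : SmoothFun n M) : dbarLambdaOne Λ (dbarLambdaZero Λ f) = 0 := by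
  have h := dbarVec_schoutenFun hΛ f
  simp [dbarLambdaOne, dbarLambdaZero, dbarOne, schoutenOne, dbarZero, schoutenZero,
    schoutenVec_schoutenFun hΛ f, dbarForm_dbarFun f, h]

end Square

/-! ### Holomorphic functions on a compact manifold -/

section Holomorphic

variable {n : ℕ} {M : Type*} [TopologicalSpace M] [ChartedSpace (Cn n) M]

/-- A real linear functional without conjugate linear part is complex linear. -/
theorem exists_restrictScalars_eq {T : Cn n →L[ℝ] ℂ} (hT : conjPart T = 0) :
    ∃ A : Cn n →L[ℂ] ℂ, A.restrictScalars ℝ = T := by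
  have h (v : Cn n) : T v = linPart T v := by
    have hv : (T v + Complex.I * T (Complex.I • v)) / 2 = 0 := DFunLike.congr_fun hT v
    change T v = (T v - Complex.I * T (Complex.I • v)) / 2
    linear_combination hv
  exact ⟨⟨linPart T, T.continuous.congr h⟩, ContinuousLinearMap.ext fun v => (h v).symm⟩

/-- The Cauchy–Riemann equations: with no conjugate linear part, the real differential is complex
linear and so is a complex derivative. -/
theorem mdifferentiable_of_dbarAt_eq_zero {f : M → ℂ} (hf : f ∈ SmoothFun n M)
    (h : ∀ x, dbarAt n f x = 0) : MDifferentiable 𝓘(ℂ, Cn n) 𝓘(ℂ, ℂ) f := fun x => by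
  have h1 : HasMFDerivAt 𝓘(ℝ, Cn n) 𝓘(ℝ, ℂ) f x (realDeriv f x) :=
    (ContMDiff.mdifferentiableAt hf (by simp)).hasMFDerivAt
  obtain ⟨A, hA⟩ := exists_restrictScalars_eq (T := realDeriv f x) (h x)
  -- The real and the complex model give the same chart expression of `f`, so the real derivative
  -- can be read in the complex chart.
  have h2 : HasFDerivWithinAt (writtenInExtChartAt 𝓘(ℂ, Cn n) 𝓘(ℂ, ℂ) x f) (realDeriv f x)
    (Set.range 𝓘(ℂ, Cn n)) (extChartAt 𝓘(ℂ, Cn n) x x) := h1.2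
  rw [← hA, ModelWithCorners.Boundaryless.range_eq_univ, hasFDerivWithinAt_univ] at h2
  have h3 : HasFDerivAt (writtenInExtChartAt 𝓘(ℂ, Cn n) 𝓘(ℂ, ℂ) x f) A
    (extChartAt 𝓘(ℂ, Cn n) x x) := hasFDerivAt_of_restrictScalars ℝ h2 rfl
  exact HasMFDerivAt.mdifferentiableAt (f' := A) ⟨h1.1, h3.hasFDerivWithinAt⟩

variable [IsManifold 𝓘(ℂ, Cn n) ω M] [CompactSpace M]

/-- On a compact manifold `∂̄f = 0` implies `[Λ, f] = 0`, because `f` is locally constant. -/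
theorem schoutenFun_eq_zero (Λ : SmoothBiv n M) {f : SmoothFun n M} (h : dbarFun f = 0) :
    schoutenFun Λ f = 0 := by
  have : IsManifold 𝓘(ℂ, Cn n) 1 M := IsManifold.of_le (n := ω) le_top
  have hd : ∀ x, dbarAt n f.1 x = 0 := congrFun (congrArg Subtype.val h)
  -- Compactness enters here, through the maximum modulus principle. Since `M` may be disconnected,
  -- `f` is only locally constant, which suffices for its differential to vanish.
  have hl : IsLocallyConstant f.1 := (mdifferentiable_of_dbarAt_eq_zero f.2 hd).isLocallyConstant
  refine Subtype.ext (funext fun x => PiLp.ext fun i => ?_)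
  have hr : realDeriv (n := n) f.1 x = 0 :=
    Filter.EventuallyEq.mfderiv_eq (f := fun _ => f.1 x) (hl.eventually_eq x) |>.trans
      mfderiv_const
  have hz : delAt n f.1 x = 0 :=
    LinearMap.ext fun v => by
      change linPart (realDeriv (n := n) f.1 x) v = 0
      rw [hr]
      simp [linPart]
  change Λ.1 x ![coord i, delAt n f.1 x] = 0
  rw [hz]
  exact (Λ.1 x).map_coord_zero 1 rfl

end Holomorphic

/-! ### The comparison map -/

section Comparison

variable {n : ℕ} {M : Type*} [TopologicalSpace M] [ChartedSpace (Cn n) M]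

theorem dbarLambdaOne_apply (Λ : SmoothBiv n M) (Z : SmoothVec n M) (η : SmoothForm n M) :
    dbarLambdaOne Λ (Z, η) = (schoutenVec Λ Z, dbarVec Z + schoutenForm Λ η, dbarForm η) := by
  simp [dbarLambdaOne, dbarOne, schoutenOne]

/-- `[Λ, W]` and `∂̄W` lie in different summands of `∧² L`, so they cannot cancel and must vanish
separately. -/
theorem dbarLambdaOne_inl_eq_zero_iff (Λ : SmoothBiv n M) (W : SmoothVec n M) :
    dbarLambdaOne Λ (W, 0) = 0 ↔ W ∈ poissonFields Λ := by
  rw [dbarLambdaOne_apply, map_zero, map_zero, add_zero, Prod.mk_eq_zero, Prod.mk_eq_zero,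
    and_iff_left rfl, and_comm]
  rfl

variable [IsManifold 𝓘(ℂ, Cn n) ω M]

theorem dbarLambdaZero_apply (Λ : SmoothBiv n M) (f : SmoothFun n M) :
    dbarLambdaZero Λ f = (schoutenFun Λ f, dbarFun f) := by
  simp [dbarLambdaZero, dbarZero, schoutenZero]

/-- The linear map `W ↦ [W]` from Poisson vector fields to the cohomology of `∂̄_Λ`. -/
def poissonFieldsToH1 (Λ : SmoothBiv n M) : poissonFields Λ →ₗ[ℂ] H1Lambda Λ :=
  Submodule.mkQ _ ∘ₗ LinearMap.codRestrict (LinearMap.ker (dbarLambdaOne Λ))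
    (LinearMap.inl ℂ _ _ ∘ₗ (poissonFields Λ).subtype)
    fun W => (dbarLambdaOne_inl_eq_zero_iff Λ W.1).2 W.2

theorem poissonFieldsToH1_injective [CompactSpace M] (Λ : SmoothBiv n M) :
    Function.Injective (poissonFieldsToH1 Λ) := by
  refine (injective_iff_map_eq_zero _).2 fun W hW => ?_
  obtain ⟨f, hf⟩ : ∃ f, dbarLambdaZero Λ f = ((W : SmoothVec n M), 0) :=
    (Submodule.Quotient.mk_eq_zero _).1 hW
  rw [dbarLambdaZero_apply, Prod.mk.injEq] at hf
  exact Subtype.ext (hf.1.symm.trans (schoutenFun_eq_zero Λ hf.2))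

theorem exists_dbarFun_eq (hO : Subsingleton (DolbeaultH1 n M)) {η : SmoothForm n M}
    (hη : dbarForm η = 0) : ∃ f, dbarFun f = η :=
  (Submodule.Quotient.mk_eq_zero _).1
    (hO.elim (cohomologyClass (dbarFun : SmoothFun n M →ₗ[ℂ] _) dbarForm η hη) 0)

theorem poissonFieldsToH1_surjective {Λ : SmoothBiv n M} (hΛ : IsHolomorphicPoisson Λ)
    (hO : Subsingleton (DolbeaultH1 n M)) : Function.Surjective (poissonFieldsToH1 Λ) := by
  intro c
  obtain ⟨⟨⟨Z, η⟩, hc⟩, rfl⟩ := Submodule.Quotient.mk_surjective _ c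
  rw [LinearMap.mem_ker] at hc
  have hη : dbarForm η = 0 := by
    rw [dbarLambdaOne_apply] at hc
    exact congrArg (fun w => w.2.2) hc
  obtain ⟨f, rfl⟩ := exists_dbarFun_eq hO hη
  -- Subtracting `∂̄_Λ f` removes the form component without changing the class.
  have hsub : ((Z - schoutenFun Λ f, 0) : SmoothL n M) = (Z, dbarFun f) - dbarLambdaZero Λ f := by
    simp [dbarLambdaZero_apply]
  have hW : Z - schoutenFun Λ f ∈ poissonFields Λ := by
    rw [← dbarLambdaOne_inl_eq_zero_iff, hsub, map_sub, hc, dbarLambdaOne_dbarLambdaZero hΛ,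
      sub_zero]
  refine ⟨⟨_, hW⟩, (Submodule.Quotient.eq _).2 ?_⟩
  -- The difference is taken as new representative minus old one, which is `-∂̄_Λ f`.
  refine ⟨-f, ?_⟩
  rw [map_neg]
  change _ = ((Z - schoutenFun Λ f, 0) : SmoothL n M) - (Z, dbarFun f)
  rw [hsub]
  abel

end Comparison

end HolPoisson

end

theorem proposition4p5 (n : ℕ) (M : Type*) [TopologicalSpace M] [T2Space M] [CompactSpace M]
    [ChartedSpace (HolPoisson.Cn n) M] [IsManifold 𝓘(ℂ, HolPoisson.Cn n) ω M]
    (Λ : HolPoisson.SmoothBiv n M) (hΛ : HolPoisson.IsHolomorphicPoisson Λ)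
    (hO : Subsingleton (HolPoisson.DolbeaultH1 n M)) :
    ∃ e : HolPoisson.poissonFields Λ ≃ₗ[ℂ] HolPoisson.H1Lambda Λ,
      ∀ W : HolPoisson.poissonFields Λ,
        ∃ hW : HolPoisson.dbarLambdaOne Λ ((W : HolPoisson.SmoothVec n M), 0) = 0,
          e W = HolPoisson.cohomologyClass (HolPoisson.dbarLambdaZero Λ)
            (HolPoisson.dbarLambdaOne Λ) ((W : HolPoisson.SmoothVec n M), 0) hW := by
  refine ⟨LinearEquiv.ofBijective (HolPoisson.poissonFieldsToH1 Λ)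
    ⟨HolPoisson.poissonFieldsToH1_injective Λ, HolPoisson.poissonFieldsToH1_surjective hΛ hO⟩,
    fun W => ⟨(HolPoisson.dbarLambdaOne_inl_eq_zero_iff Λ W.1).2 W.2, rfl⟩⟩
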